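/- Let $K$ be a commutative field of any characteristic and $\mathcal D$ a set. A planar rooted forest decorated by $\mathcal D$ is a finite (possibly empty) sequence $F=t_1\cdots t_n$ of planar rooted trees whose vertices are decorated by elements of $\mathcal D$; $\mathbb F^{\mathcal D}$ is the set of these forests, $1$ the empty forest, $vert(F)$ the set of vertices of $F$. Let $\mathcal H$ be the free associative unital $K$-algebra on the planar decorated trees; $\mathbb F^{\mathcal D}$ is a basis of $\mathcal H$ and the product is concatenation. Let $\varepsilon:\mathcal H\to K$ be linear with $\varepsilon(1)=1$ and $\varepsilon(F)=0$ for $F\ne 1$, and $\mathcal A=\ker\varepsilon$. For $d\in\mathcal D$ let $B_d^+$ be the linear map that sends a forest to the tree obtained by grafting its trees on a common root decorated by $d$, and $\bullet_d=B_d^+(1)$. *Products.* $\mathcal A$ is the free dendriform algebra on the $\bullet_d$: its bilinear operations $\prec,\succ$ satisfy $x\prec y+x\succ y=xy$ and are given, for forests $C$, $H$ and $G\neq 1$ and a tree $t=B_d^+(C)$, by $t\prec G=B_d^+(CG)$ and, if $H\ne1$, $(tH)\prec G=B_d^+(CHG)+t\,(H\prec G)-B_d^+\big(C\,(H\prec G)\big)$.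 *Coproducts.* An admissible cut $c$ of a tree is a set of edges meeting every path from the root upward at most once (possibly empty), or the total cut; an admissible cut of a forest is a tuple of admissible cuts of its trees. Write $R^c(F)$ for the forest of the components containing the original roots of the trees that are not totally cut, and $P^c(F)$ for the forest of the other components, in the same order (a totally cut tree goes to $P^c(F)$). For $F\neq 1$, $\Delta_\prec(F)=\sum_c P^c(F)\otimes R^c(F)$, where $c$ runs over the admissible cuts with $R^c(F)\ne 1$ which are total on the last tree of $F$ or cut an edge on the path from the root of the last tree to the rightmost leaf of $F$; $\Delta_\succ(F)$ is the same sum over the other admissible cuts, with $P^c(F)\neq1$. *Pairing.* There is a unique bilinear form $\langle\cdot,\cdot\rangle$ on $\mathcal H$ such that $\langle 1,y\rangle=\varepsilon(y)$ and $\langle x,1\rangle=\varepsilon(x)$ for all $x,y\in\mathcal H$; $\langle\bullet_d,\bullet_{d'}\rangle=\delta_{d,d'}$ for all $d,d'\in\mathcal D$; and, for all $a,a_1,a_2,b,b_1,b_2\in\mathcal A$, $$\langle a_1\prec a_2,b\rangle=\langle a_1\otimes a_2,\Delta_\prec(b)\rangle,\qquad \langle a_1\succ a_2,b\rangle=\langle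 a_1\otimes a_2,\Delta_\succ(b)\rangle,$$ $$\langle a,b_1\prec b_2\rangle=\langle\Delta_\prec(a),b_1\otimes b_2\rangle,\qquad \langle a,b_1\succ b_2\rangle=\langle\Delta_\succ(a),b_1\otimes b_2\rangle,$$ where $\langle x\otimes y,x'\otimes y'\rangle=\langle x,x'\rangle\langle y,y'\rangle$. *Orders.* For vertices $x,y$ of a forest, write $x\geq_{high}y$ if there is an upward (possibly trivial) path from $y$ to $x$, i.e. $y=x$ or $y$ is an ancestor of $x$; write $x\geq_{left}y$ if $x,y$ are not comparable for $\geq_{high}$ and $x$ is more on the left than $y$; and write $x\geq_{d,l}y$ if $x\geq_{left}y$ or $y\geq_{high}x$. **Theorem.** The unique pairing above exists and, for all $F,G\in\mathbb F^{\mathcal D}$, $\langle F,G\rangle$ is (the image in $K$ of) the number of bijections $f:vert(F)\to vert(G)$ such that 1. for all $x,y\in vert(F)$, $x\geq_{high}y\Rightarrow f(x)\geq_{d,l}f(y)$; 2. for all $x,y\in vert(F)$, $f(x)\geq_{high}f(y)\Rightarrow x\geq_{d,l}y$; 3. for all $x\in vert(F)$, $x$ and $f(x)$ have the same decoration. -/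

import Mathlib

open scoped TensorProduct

noncomputable section

/-- Planar rooted forests with vertices decorated by `D`: finite sequences of planar decorated
rooted trees. `nil` is the empty forest and `cons d c r` is the forest whose first (leftmost) tree
has a root decorated by `d` carrying the forest of subtrees `c` (from left to right), and whose
remaining trees form the forest `r`. A tree is a forest of the form `cons d c nil`. -/
inductive PlanarForest (D : Type*) where
  | nil : PlanarForest D
  | cons (d : D) (c r : PlanarForest D) : PlanarForest D

namespace PlanarForest

variable {D : Type*}

/-! ### Vertices and their orders -/

/-- The vertices of a forest: for `cons d c r`, the root of the first tree, the other vertices of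
the first tree, and the vertices of the remaining trees. -/
inductive Vertex : PlanarForest D → Type _ where
  | root {d : D} {c r : PlanarForest D} : Vertex (cons d c r)
  | above {d : D} {c r : PlanarForest D} (x : Vertex c) : Vertex (cons d c r)
  | rest {d : D} {c r : PlanarForest D} (x : Vertex r) : Vertex (cons d c r)

/-- The decoration of a vertex. -/
def Vertex.deco : {F : PlanarForest D} → Vertex F → D
  | cons d _ _, .root => d
  | cons _ _ _, .above x => x.deco
  | cons _ _ _, .rest x => x.deco

/-- `GeHigh x y` is `x ≥_high y`: there is an (upward, possibly trivial) path from `y` to `x`,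
that is, `y` is `x` or an ancestor of `x`. Roots are at the bottom. -/
inductive GeHigh : {F : PlanarForest D} → Vertex F → Vertex F → Prop where
  | root_root {d : D} {c r : PlanarForest D} :
      GeHigh (F := cons d c r) .root .root
  | above_root {d : D} {c r : PlanarForest D} (x : Vertex c) :
      GeHigh (F := cons d c r) (.above x) .root
  | above_above {d : D} {c r : PlanarForest D} {x y : Vertex c} (h : GeHigh x y) :
      GeHigh (F := cons d c r) (.above x) (.above y)
  | rest_rest {d : D} {c r : PlanarForest D} {x y : Vertex r} (h : GeHigh x y) :
      GeHigh (F := cons d c r) (.rest x) (.rest y)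

/-- `GeLeft x y` is `x ≥_left y`: the vertices `x` and `y` are not comparable for `≥_high`, and
`x` is more on the left than `y`. -/
inductive GeLeft : {F : PlanarForest D} → Vertex F → Vertex F → Prop where
  | root_rest {d : D} {c r : PlanarForest D} (y : Vertex r) :
      GeLeft (F := cons d c r) .root (.rest y)
  | above_rest {d : D} {c r : PlanarForest D} (x : Vertex c) (y : Vertex r) :
      GeLeft (F := cons d c r) (.above x) (.rest y)
  | above_above {d : D} {c r : PlanarForest D} {x y : Vertex c} (h : GeLeft x y) :
      GeLeft (F := cons d c r) (.above x) (.above y)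
  | rest_rest {d : D} {c r : PlanarForest D} {x y : Vertex r} (h : GeLeft x y) :
      GeLeft (F := cons d c r) (.rest x) (.rest y)

/-- The total order `x ≥_{d,l} y` on the vertices: `x ≥_left y` or `y ≥_high x`. -/
def GeDL {F : PlanarForest D} (x y : Vertex F) : Prop := GeLeft x y ∨ GeHigh y x

/-- The set `I(F, G)` of bijections `f : vert(F) → vert(G)` with the two order compatibilities and
preserving the decorations. -/
def compatBij (F G : PlanarForest D) : Set (Vertex F ≃ Vertex G) :=
  {f | (∀ x y, GeHigh x y → GeDL (f x) (f y)) ∧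
       (∀ x y, GeHigh (f x) (f y) → GeDL x y) ∧
       ∀ x, x.deco = (f x).deco}

theorem Vertex.finite : ∀ F : PlanarForest D, Finite (Vertex F)
  | nil => Finite.of_injective (β := Empty) (fun x => nomatch x) (fun x => nomatch x)
  | cons d c r =>
    have := Vertex.finite c
    have := Vertex.finite r
    Finite.of_surjective
      (fun z : Option (Vertex c ⊕ Vertex r) => match z with
        | none => (.root : Vertex (cons d c r))
        | some (.inl x) => .above x
        | some (.inr x) => .rest x)
      (fun v => match v with
        | .root => ⟨none, rfl⟩
        | .above x => ⟨some (.inl x), rfl⟩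
        | .rest x => ⟨some (.inr x), rfl⟩)

instance (F : PlanarForest D) : Finite (Vertex F) := Vertex.finite F

/-! ### The algebra of forests -/

/-- Concatenation of forests. -/
def append : PlanarForest D → PlanarForest D → PlanarForest D
  | nil, G => G
  | cons d c r, G => cons d c (append r G)

theorem append_nil : ∀ F : PlanarForest D, append F nil = F
  | nil => rfl
  | cons d c r => congrArg (cons d c) (append_nil r)

theorem append_assoc : ∀ F G H : PlanarForest D, append (append F G) H = append F (append G H)
  | nil, _, _ => rfl
  | cons d c r, G, H => congrArg (cons d c) (append_assoc r G H)

/-- Forests form the free monoid on the set of trees: the product is the concatenation, and the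
unit is the empty forest. -/
instance : Monoid (PlanarForest D) where
  mul := append
  one := nil
  mul_assoc := append_assoc
  one_mul _ := rfl
  mul_one := append_nil

/-- The tree obtained by grafting the trees of `F` on a common root decorated by `d`. -/
def graft (d : D) (F : PlanarForest D) : PlanarForest D := cons d F nil

/-! ### Admissible cuts -/

/-- The admissible cuts of a forest, the empty and the total ones included. An admissible cut of
`t₁ ... tₙ` is a tuple of cuts of the `tᵢ`. A cut of a tree is either the total cut (`none`), or
(`some k`) it keeps the root and is given by an admissible cut `k` of the forest of subtrees of the
root, where cutting a subtree totally means cutting the edge between the root and this subtree. -/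
def AdmCut : PlanarForest D → Type
  | nil => Unit
  | cons _ c r => Option (AdmCut c) × AdmCut r

/-- There are finitely many admissible cuts. -/
instance AdmCut.instFintype : (F : PlanarForest D) → Fintype (AdmCut F)
  | nil => inferInstanceAs (Fintype Unit)
  | cons _ c r =>
    letI := AdmCut.instFintype c
    letI := AdmCut.instFintype r
    inferInstanceAs (Fintype (Option (AdmCut c) × AdmCut r))

/-- `P^c(F)`: the forest of the components which are cut off, in the same order. -/
def pruned : (F : PlanarForest D) → AdmCut F → PlanarForest D
  | nil, _ => 1
  | cons d c r, (none, s) => graft d c * pruned r s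
  | cons _ c r, (some k, s) => pruned c k * pruned r s

/-- `R^c(F)`: the forest of the components which contain the roots that are kept. -/
def trunk : (F : PlanarForest D) → AdmCut F → PlanarForest D
  | nil, _ => 1
  | cons _ _ r, (none, s) => trunk r s
  | cons d c r, (some k, s) => graft d (trunk c k) * trunk r s

/-- The cut is total on the last tree of `F`, or cuts one of the edges on the path from the root
of the last tree of `F` to the rightmost leaf of `F`. -/
def CutsRight : (F : PlanarForest D) → AdmCut F → Prop
  | nil, _ => False
  | cons _ _ nil, (none, _) => True
  | cons _ c nil, (some k, _) => CutsRight c k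
  | cons _ _ (cons d c r), (_, s) => CutsRight (cons d c r) s

/-! ### The Hopf algebra `H` of planar decorated forests and its bidendriform structure -/

/-- The free associative algebra on the planar decorated trees; the forests are a basis. -/
abbrev HAlg (K : Type*) [Field K] (D : Type*) := MonoidAlgebra K (PlanarForest D)

variable (K : Type*) [Field K]

/-- A forest as an element of the algebra. -/
def ofForest (F : PlanarForest D) : HAlg K D := MonoidAlgebra.single F 1

/-- The linear map with given values on the basis of forests. -/
def extend {M : Type*} [AddCommGroup M] [Module K M] (φ : PlanarForest D → M) : HAlg K D →ₗ[K] M :=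
  (MonoidAlgebra.basis (PlanarForest D) K).constr K φ

open Classical in
/-- The counit: `ε(F) = 1` if `F` is the empty forest and `ε(F) = 0` otherwise. -/
def counit : HAlg K D →ₗ[K] K := extend K fun F => if F = 1 then 1 else 0

/-- The augmentation ideal, with basis the nonempty forests. -/
def augIdeal (K : Type*) [Field K] (D : Type*) : Submodule K (HAlg K D) := LinearMap.ker (counit K)

/-- The linear map `B⁺_d`. -/
def bPlus (d : D) : HAlg K D →ₗ[K] HAlg K D := extend K fun F => ofForest K (graft d F)

/-- The single vertex decorated by `d`. -/
def dot (d : D) : HAlg K D := ofForest K (graft d 1)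

/-- The left dendriform product of two nonempty forests (with `1 ≺ G = 0`). For a tree `t = B⁺_d(c)`
and forests `H`, `G` it satisfies `t ≺ G = B⁺_d(c G)` and
`(t H) ≺ G = t ≺ (H G) + t ≻ (H ≺ G)`, where `x ≻ y = x y - x ≺ y`. The dendriform axioms
and `dot d ≺ x = B⁺_d(x)` force these identities. -/
def precForest : PlanarForest D → PlanarForest D → HAlg K D
  | nil, _ => 0
  | cons d c r, G =>
    ofForest K (graft d (c * (r * G)))
      + (ofForest K (graft d c) * precForest r G - bPlus K d (ofForest K c * precForest r G))

/-- The left dendriform product `≺`. Only its values on the augmentation ideal matter. -/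
def prec : HAlg K D →ₗ[K] HAlg K D →ₗ[K] HAlg K D :=
  extend K fun F => extend K fun G => precForest K F G

/-- The right dendriform product `≻`: the product is the sum of `≺` and `≻`. -/
def succ : HAlg K D →ₗ[K] HAlg K D →ₗ[K] HAlg K D := LinearMap.mul K (HAlg K D) - prec K

open Classical in
/-- The left coproduct `Δ_≺`: the sum of `P^c(F) ⊗ R^c(F)` over the admissible cuts `c` of `F`
with `CutsRight F c`, the total cut (`R^c(F) = 1`) being excluded. -/
def deltaPrec : HAlg K D →ₗ[K] HAlg K D ⊗[K] HAlg K D :=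
  extend K fun F => ∑ c : AdmCut F with CutsRight F c ∧ trunk F c ≠ 1,
    ofForest K (pruned F c) ⊗ₜ[K] ofForest K (trunk F c)

open Classical in
/-- The right coproduct `Δ_≻`: the sum of `P^c(F) ⊗ R^c(F)` over the other admissible cuts, the
empty cut (`P^c(F) = 1`) being excluded. -/
def deltaSucc : HAlg K D →ₗ[K] HAlg K D ⊗[K] HAlg K D :=
  extend K fun F => ∑ c : AdmCut F with ¬ CutsRight F c ∧ pruned F c ≠ 1,
    ofForest K (pruned F c) ⊗ₜ[K] ofForest K (trunk F c)

variable {K}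

/-- The bilinear form on `H ⊗ H` with `⟨a ⊗ b, a' ⊗ b'⟩ = ⟨a, a'⟩ ⟨b, b'⟩`. -/
def tensorForm (p : LinearMap.BilinForm K (HAlg K D)) :
    LinearMap.BilinForm K (HAlg K D ⊗[K] HAlg K D) :=
  LinearMap.BilinForm.tmul p p

/-- The restriction of `p` to the augmentation ideal is a bidendriform pairing. -/
structure IsBidendriformPairing (p : LinearMap.BilinForm K (HAlg K D)) : Prop where
  prec_left : ∀ a₁ ∈ augIdeal K D, ∀ a₂ ∈ augIdeal K D, ∀ b ∈ augIdeal K D,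
    p (prec K a₁ a₂) b = tensorForm p (a₁ ⊗ₜ[K] a₂) (deltaPrec K b)
  succ_left : ∀ a₁ ∈ augIdeal K D, ∀ a₂ ∈ augIdeal K D, ∀ b ∈ augIdeal K D,
    p (succ K a₁ a₂) b = tensorForm p (a₁ ⊗ₜ[K] a₂) (deltaSucc K b)
  prec_right : ∀ a ∈ augIdeal K D, ∀ b₁ ∈ augIdeal K D, ∀ b₂ ∈ augIdeal K D,
    p a (prec K b₁ b₂) = tensorForm p (deltaPrec K a) (b₁ ⊗ₜ[K] b₂)
  succ_right : ∀ a ∈ augIdeal K D, ∀ b₁ ∈ augIdeal K D, ∀ b₂ ∈ augIdeal K D,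
    p a (succ K b₁ b₂) = tensorForm p (deltaSucc K a) (b₁ ⊗ₜ[K] b₂)

open Classical in
/-- `p` is the pairing `⟨·,·⟩`: a bidendriform pairing on the augmentation ideal with
`⟨dot d, dot d'⟩ = δ_{d,d'}`, extended to `H` by `⟨1, y⟩ = ε(y)` and `⟨x, 1⟩ = ε(x)`. -/
structure IsForestPairing (p : LinearMap.BilinForm K (HAlg K D)) : Prop extends
    IsBidendriformPairing p where
  dot_dot : ∀ d d' : D, p (dot K d) (dot K d') = if d = d' then 1 else 0
  one_left : ∀ y, p 1 y = counit K y
  one_right : ∀ x, p x 1 = counit K x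

end PlanarForest

end

/-!
The counting form `⟨F, G⟩ = |I(F, G)|` is shown to be a forest pairing by rewriting the count in
terms of words, as in the algebra of free quasi-symmetric functions.

Give the vertices of `G` keys that increase along the total order opposite to `≥_{d,l}`, that is,
from the root upwards and from left to right. A bijection `f : vert(F) → vert(G)` is the same as a
word in the vertices of `G`, namely the list of the images of the vertices of `F` taken in this
order. The second condition on `f` depends only on `G`: the word is a linear extension of `G`
(`linWords`), each vertex coming before its ancestors. The other two depend only on `F`: the word
matches `F` (`Matches`), the key on a vertex being larger than the keys above it. Hence `⟨x, G⟩` is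
the sum of the linear forms `evalWord w x` over the linear extensions `w` of `G`
(`evalLin_eq_card`).

On the side of `F`, words are concatenated. A word matches `F₁ F₂` if it is `u v` with `u` matching
`F₁` and `v` matching `F₂`, and grafting more trees on the right of a root only adds the constraint
that the root carries the largest key. It follows that evaluating `F₁ ≺ F₂` keeps exactly the
splittings `u v` whose largest key occurs in `u` (`evalWord_precForest`).

On the side of `G`, words are cut in two. The first letters of a linear extension form an upper set,
and upper sets correspond to admissible cuts, so splittings of linear extensions of `G` are pairs of
linear extensions of `P^c(G)` and `R^c(G)` (`sum_linWords_take_drop`). The vertex with the largest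
key is the rightmost leaf of the last tree, so the condition on the largest key selects the cuts of
`Δ_≺` (`cutsRight_iff_dominates`). This gives the two identities for products on the left, and the
other two hold because `f ↦ f⁻¹` makes the form symmetric.

For uniqueness, every nonempty forest is a single vertex or is obtained from smaller forests by `≺`
and `≻` (`exists_dendriform_decomposition`), and both coproducts of a single vertex vanish, so the
axioms determine all values by induction.
-/

noncomputable section

namespace PlanarForest

/-! ### Words matching a forest -/

section

variable {D : Type*}

theorem cons_mul (d : D) (c r G : PlanarForest D) : cons d c r * G = cons d c (r * G) := rfl

theorem nil_mul (G : PlanarForest D) : nil * G = G := rfl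

theorem one_eq_nil : (1 : PlanarForest D) = nil := rfl

theorem graft_mul (d : D) (c G : PlanarForest D) : graft d c * G = cons d c G := rfl

/-- The number of vertices. -/
def size : PlanarForest D → ℕ
  | nil => 0
  | cons _ c r => size c + size r + 1

theorem size_graft (d : D) (c : PlanarForest D) : size (graft d c) = size c + 1 := rfl

/-- `Matches F w` says that the letters of `w` can be put on the vertices of `F`, in the order in
which the vertices are met from the root upwards and from left to right, so that decorations agree
and the key of a vertex is larger than the keys of its descendants. -/
def Matches : PlanarForest D → List (ℕ × D) → Prop
  | nil, w => w = []
  | cons d c r, w => ∃ a u v, w = a :: (u ++ v) ∧ a.2 = d ∧ (∀ b ∈ u, b.1 < a.1) ∧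
      Matches c u ∧ Matches r v

theorem Matches.length_eq {F : PlanarForest D} {w : List (ℕ × D)} (h : Matches F w) :
    w.length = size F := by
  induction F generalizing w with
  | nil => simp [Matches] at h; simp [h, size]
  | cons d c r ihc ihr =>
    obtain ⟨a, u, v, rfl, -, -, hu, hv⟩ := h
    simp [size, ihc hu, ihr hv]

theorem matches_mul {F G : PlanarForest D} {w : List (ℕ × D)} :
    Matches (F * G) w ↔ ∃ u v, w = u ++ v ∧ Matches F u ∧ Matches G v := by
  induction F generalizing w with
  | nil => simp [nil_mul, Matches]
  | cons d c r _ ih =>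
    rw [cons_mul]
    constructor
    · rintro ⟨a, u, v, rfl, ha, hau, hu, hv⟩
      obtain ⟨v₁, v₂, rfl, h₁, h₂⟩ := ih.1 hv
      exact ⟨a :: (u ++ v₁), v₂, by simp, ⟨a, u, v₁, rfl, ha, hau, hu, h₁⟩, h₂⟩
    · rintro ⟨_, v₂, rfl, ⟨a, u, v₁, rfl, ha, hau, hu, h₁⟩, h₂⟩
      exact ⟨a, u, v₁ ++ v₂, by simp, ha, hau, hu, ih.2 ⟨v₁, v₂, rfl, h₁, h₂⟩⟩

theorem matches_mul_iff_take_drop {F G : PlanarForest D} {w : List (ℕ × D)} :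
    Matches (F * G) w ↔ Matches F (w.take (size F)) ∧ Matches G (w.drop (size F)) := by
  rw [matches_mul]
  constructor
  · rintro ⟨u, v, rfl, hu, hv⟩
    rw [← hu.length_eq]
    simpa using ⟨hu, hv⟩
  · rintro ⟨hu, hv⟩
    exact ⟨_, _, (List.take_append_drop _ _).symm, hu, hv⟩

theorem matches_graft {d : D} {c : PlanarForest D} {w : List (ℕ × D)} :
    Matches (graft d c) w ↔ ∃ a u, w = a :: u ∧ a.2 = d ∧ (∀ b ∈ u, b.1 < a.1) ∧ Matches c u := by
  constructor
  · rintro ⟨a, u, v, rfl, ha, hau, hu, rfl⟩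
    exact ⟨a, u, by simp, ha, hau, hu⟩
  · rintro ⟨a, u, rfl, ha, hau, hu⟩
    exact ⟨a, u, [], by simp, ha, hau, hu, rfl⟩

/-- The first letter of the word has the strictly largest key. -/
def HeadMax (w : List (ℕ × D)) : Prop := ∃ a u, w = a :: u ∧ ∀ b ∈ u, b.1 < a.1

/-- Grafting `G` on the root of a tree, to the right of the subtrees, does not change the order of
the vertices; it only adds the constraint that the letter of the root exceeds all the others. -/
theorem matches_graft_mul {d : D} {c G : PlanarForest D} {w : List (ℕ × D)} :
    Matches (graft d (c * G)) w ↔ HeadMax w ∧ Matches (graft d c * G) w := by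
  rw [matches_graft, graft_mul]
  constructor
  · rintro ⟨a, u, rfl, ha, hau, hu⟩
    obtain ⟨u, v, rfl, hu, hv⟩ := matches_mul.1 hu
    exact ⟨⟨a, _, rfl, hau⟩, a, u, v, rfl, ha, fun b hb => hau b (by simp [hb]), hu, hv⟩
  · rintro ⟨⟨a, u, h, hau⟩, a', u', v, h', ha, -, hu, hv⟩
    obtain ⟨rfl, rfl⟩ := List.cons.inj (h.symm.trans h')
    exact ⟨a, _, h', ha, hau, matches_mul.2 ⟨_, _, rfl, hu, hv⟩⟩

/-- Some key of `u` exceeds all the keys of `v`: the largest key of `u ++ v` occurs in `u`. -/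
def Dominates (u v : List (ℕ × D)) : Prop := ∃ a ∈ u, ∀ b ∈ v, b.1 < a.1

variable (K : Type*) [Field K]

theorem ofForest_mul (F G : PlanarForest D) : ofForest K F * ofForest K G = ofForest K (F * G) := by
  simp [ofForest, MonoidAlgebra.single_mul_single]

@[simp]
theorem extend_ofForest {M : Type*} [AddCommGroup M] [Module K M] (φ : PlanarForest D → M)
    (F : PlanarForest D) : extend K φ (ofForest K F) = φ F := by
  have : ofForest K F = MonoidAlgebra.basis (PlanarForest D) K F := by
    simp [ofForest]
  rw [this, extend, Module.Basis.constr_basis]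

variable {K}

theorem hAlg_hom_ext {M : Type*} [AddCommGroup M] [Module K M] {f g : HAlg K D →ₗ[K] M}
    (h : ∀ F, f (ofForest K F) = g (ofForest K F)) : f = g :=
  (MonoidAlgebra.basis (PlanarForest D) K).ext fun F => by
    simpa [ofForest] using h F

variable (K)

open Classical in
/-- The linear form on `H` whose value on a forest is `1` or `0`, according to whether the word
matches the forest. -/
def evalWord (w : List (ℕ × D)) : HAlg K D →ₗ[K] K := extend K fun F => if Matches F w then 1 else 0

variable {K}

open Classical in
theorem evalWord_ofForest (w : List (ℕ × D)) (F : PlanarForest D) :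
    evalWord K w (ofForest K F) = if Matches F w then 1 else 0 := by
  simp [evalWord]

theorem evalWord_mul (w : List (ℕ × D)) (F : PlanarForest D) (x : HAlg K D) :
    evalWord K w (ofForest K F * x) =
      evalWord K (w.take (size F)) (ofForest K F) * evalWord K (w.drop (size F)) x := by
  classical
  have : evalWord K w ∘ₗ LinearMap.mulLeft K (ofForest K F) =
      evalWord K (w.take (size F)) (ofForest K F) • evalWord K (w.drop (size F)) := by
    refine hAlg_hom_ext fun G => ?_
    simp only [LinearMap.comp_apply, LinearMap.mulLeft_apply, LinearMap.smul_apply, smul_eq_mul,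
      ofForest_mul, evalWord_ofForest, matches_mul_iff_take_drop, ite_and]
    split_ifs <;> simp
  simpa using LinearMap.congr_fun this x

open Classical in
/-- Words see `B⁺_d(c x)` as the product `B⁺_d(c) x` restricted to the words that start with their
largest key. -/
theorem evalWord_bPlus (w : List (ℕ × D)) (d : D) (c : PlanarForest D) (x : HAlg K D) :
    evalWord K w (bPlus K d (ofForest K c * x)) =
      if HeadMax w then evalWord K w (ofForest K (graft d c) * x) else 0 := by
  have : evalWord K w ∘ₗ bPlus K d ∘ₗ LinearMap.mulLeft K (ofForest K c) =
      (if HeadMax w then (1 : K) else 0) •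
        (evalWord K w ∘ₗ LinearMap.mulLeft K (ofForest K (graft d c))) := by
    refine hAlg_hom_ext fun G => ?_
    simp only [LinearMap.comp_apply, LinearMap.mulLeft_apply, LinearMap.smul_apply, smul_eq_mul,
      ofForest_mul, evalWord_ofForest, bPlus, extend_ofForest, matches_graft_mul, ite_and]
    split_ifs <;> simp
  have h := LinearMap.congr_fun this x
  simp only [LinearMap.comp_apply, LinearMap.mulLeft_apply, LinearMap.smul_apply, smul_eq_mul,
    ite_mul, one_mul, zero_mul] at h
  exact h

open Classical in
/-- Evaluation on words turns the dendriform product `F ≺ G` into the concatenations `u v`, with `u`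
matching `F` and `v` matching `G`, whose largest key occurs in `u`. -/
theorem evalWord_precForest (F G : PlanarForest D) (w : List (ℕ × D)) :
    evalWord K w (precForest K F G) =
      if Dominates (w.take (size F)) (w.drop (size F)) then
        evalWord K (w.take (size F)) (ofForest K F) * evalWord K (w.drop (size F)) (ofForest K G)
      else 0 := by
  induction F generalizing w with
  | nil => simp [precForest, size, Dominates]
  | cons d c r _ ih =>
    have hs : size (cons d c r) = size (graft d c) + size r := by simp [size, graft]; ring
    have hfirst : evalWord K w (ofForest K (graft d (c * (r * G)))) =
        if HeadMax w then evalWord K w (ofForest K (graft d c) * ofForest K (r * G)) else 0 := by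
      rw [← evalWord_bPlus, ofForest_mul, bPlus, extend_ofForest]
    have htotal : ofForest K (cons d c r) * ofForest K G =
        ofForest K (graft d c) * (ofForest K r * ofForest K G) := by
      simp only [ofForest_mul, graft_mul, cons_mul]
    rw [precForest, map_add, map_sub, hfirst, evalWord_bPlus, ← evalWord_mul w (cons d c r), htotal,
      ← ofForest_mul K r G, evalWord_mul w, evalWord_mul w, ih, evalWord_mul (w.drop _),
      List.drop_drop, hs, List.take_add]
    have hw : w = w.take (size (graft d c)) ++ ((w.drop (size (graft d c))).take (size r) ++
        w.drop (size (graft d c) + size r)) := by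
      rw [← List.drop_drop, List.take_append_drop, List.take_append_drop]
    generalize w.take (size (graft d c)) = t at *
    generalize (w.drop (size (graft d c))).take (size r) = u at *
    generalize w.drop (size (graft d c) + size r) = v at *
    by_cases ht : Matches (graft d c) t
    swap
    · simp [evalWord_ofForest t, ht]
    obtain ⟨a, t', rfl, -, hat, -⟩ := matches_graft.1 ht
    subst hw
    by_cases hm : HeadMax (a :: t' ++ (u ++ v))
    · -- The root of the first tree carries the largest key: only the first summand survives.
      have hdom : Dominates (a :: t' ++ u) v := by
        obtain ⟨a', s, h, hs⟩ := hm
        obtain ⟨rfl, rfl⟩ := List.cons.inj h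
        exact ⟨a, by simp, fun b hb => hs b (by simp [hb])⟩
      rw [if_pos hm, if_pos hm, if_pos hdom]
      ring
    · -- The largest key is not in the first tree, as its root carries the largest key there.
      have hdom : Dominates (a :: t' ++ u) v ↔ Dominates u v := by
        constructor
        · rintro ⟨b, hb, hbv⟩
          rcases List.mem_append.1 hb with hb | hb
          swap
          · exact ⟨b, hb, hbv⟩
          have hba : b.1 ≤ a.1 := by
            rcases List.mem_cons.1 hb with rfl | hb
            exacts [le_rfl, (hat b hb).le]
          by_contra hu
          refine hm ⟨a, t' ++ (u ++ v), rfl, fun e he => ?_⟩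
          rcases List.mem_append.1 he with he | he
          · exact hat e he
          rcases List.mem_append.1 he with he | he
          · by_contra hea
            exact hu ⟨e, he, fun f hf => (hbv f hf).trans_le (by omega)⟩
          · exact (hbv e he).trans_le hba
        · rintro ⟨b, hb, hbv⟩
          exact ⟨b, by simp [hb], hbv⟩
      simp only [hm, hdom, if_false]
      split_ifs <;> simp

end

/-! ### Linear extensions of a labelled forest -/

section

variable {V : Type*}

/-- The decorations of the vertices, in the order in which the vertices are met from the root
upwards and from left to right. -/
def labels : PlanarForest V → List V
  | nil => []
  | cons d c r => d :: (labels c ++ labels r)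

/-- `Above F a b`: some vertex labelled by `a` is strictly above a vertex labelled by `b`. This is
of interest for forests whose labels are pairwise distinct, where the labels stand for the
vertices. -/
def Above : PlanarForest V → V → V → Prop
  | nil, _, _ => False
  | cons d c r, a, b => (b = d ∧ a ∈ labels c) ∨ Above c a b ∨ Above r a b

theorem labels_one : labels (1 : PlanarForest V) = [] := rfl

theorem labels_graft (d : V) (c : PlanarForest V) : labels (graft d c) = d :: labels c := by
  simp [graft, labels]

theorem labels_mul (F G : PlanarForest V) : labels (F * G) = labels F ++ labels G := by
  induction F with
  | nil => rfl
  | cons d c r _ ih => simp [cons_mul, labels, ih]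

theorem above_mul {F G : PlanarForest V} {a b : V} :
    Above (F * G) a b ↔ Above F a b ∨ Above G a b := by
  induction F with
  | nil => simp [nil_mul, Above]
  | cons d c r _ ih => simp only [cons_mul, Above, ih]; tauto

theorem Above.mem {F : PlanarForest V} {a b : V} (h : Above F a b) :
    a ∈ labels F ∧ b ∈ labels F := by
  induction F with
  | nil => exact h.elim
  | cons d c r ihc ihr =>
    simp only [labels, List.mem_cons, List.mem_append]
    rcases h with ⟨rfl, h⟩ | h | h
    · simp [h]
    · simp [ihc h]
    · simp [ihr h]

/-- The linear extensions of the labelled forest `F`: the words that enumerate its labels, each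
label coming before the labels of its ancestors. -/
def linWords (F : PlanarForest V) : Finset (List V) :=
  open Classical in
  (labels F).permutations.toFinset.filter fun w => w.Pairwise fun a b => ¬ Above F b a

theorem mem_linWords {F : PlanarForest V} {w : List V} :
    w ∈ linWords F ↔ w.Perm (labels F) ∧ w.Pairwise fun a b => ¬ Above F b a := by
  simp [linWords]

/-! ### Admissible cuts of a labelled forest -/

theorem labels_pruned_append_trunk_perm (F : PlanarForest V) (c : AdmCut F) :
    (labels (pruned F c) ++ labels (trunk F c)).Perm (labels F) := by
  classical
  induction F with
  | nil => exact List.Perm.refl _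
  | cons d C r ihC ihr =>
    rcases c with ⟨_ | k, s⟩
    · have := ihr s
      simp only [pruned, trunk, graft_mul, labels, List.cons_append, List.append_assoc]
      exact (this.append_left _).cons _
    · have h₁ := ihC k
      have h₂ := ihr s
      simp only [pruned, trunk, graft_mul, labels, labels_mul]
      rw [List.perm_iff_count] at *
      intro a
      have h₁ := h₁ a
      have h₂ := h₂ a
      simp only [List.count_append, List.count_cons] at *
      omega

theorem labels_pruned_sublist (F : PlanarForest V) (c : AdmCut F) :
    (labels (pruned F c)).Sublist (labels F) := by
  induction F with
  | nil => exact List.Sublist.refl _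
  | cons d C r ihC ihr =>
    rcases c with ⟨_ | k, s⟩
    · simp only [pruned, graft_mul, labels]
      exact ((List.Sublist.refl _).append (ihr s)).cons_cons _
    · simp only [pruned, labels, labels_mul]
      exact ((ihC k).append (ihr s)).cons _

theorem labels_trunk_sublist (F : PlanarForest V) (c : AdmCut F) :
    (labels (trunk F c)).Sublist (labels F) := by
  induction F with
  | nil => exact List.Sublist.refl _
  | cons d C r ihC ihr =>
    rcases c with ⟨_ | k, s⟩
    · simp only [trunk, labels]
      exact ((ihr s).trans (List.sublist_append_right _ _)).cons _
    · simp only [trunk, graft_mul, labels]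
      exact ((ihC k).append (ihr s)).cons_cons _

theorem nodup_labels_cons {d : V} {C r : PlanarForest V} :
    (labels (cons d C r)).Nodup ↔ d ∉ labels C ∧ d ∉ labels r ∧ (labels C).Nodup ∧
      (labels r).Nodup ∧ ∀ a ∈ labels C, a ∉ labels r := by
  simp only [labels, List.nodup_cons, List.mem_append, List.nodup_append']
  simp only [List.Disjoint]
  tauto

/-- The vertices cut off by an admissible cut form an upper set of the forest. -/
theorem above_pruned_iff {F : PlanarForest V} (hF : (labels F).Nodup) (c : AdmCut F) {a b : V} :
    Above (pruned F c) a b ↔ Above F a b ∧ b ∈ labels (pruned F c) := by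
  induction F with
  | nil => simp [pruned, one_eq_nil, Above]
  | cons d C r ihC ihr =>
    obtain ⟨hdC, hdr, hC, hr, hCr⟩ := nodup_labels_cons.1 hF
    rcases c with ⟨_ | k, s⟩
    · have h := ihr hr s
      have hs := fun b => (labels_pruned_sublist r s).subset (a := b)
      have h₁ := fun a b => Above.mem (F := C) (a := a) (b := b)
      have h₂ := fun a b => Above.mem (F := r) (a := a) (b := b)
      simp only [pruned, graft_mul, Above, labels, List.mem_cons, List.mem_append]
      grind
    · have h := ihr hr s
      have h' := ihC hC k
      have hs := fun b => (labels_pruned_sublist r s).subset (a := b)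
      have hk := fun b => (labels_pruned_sublist C k).subset (a := b)
      have h₁ := fun a b => Above.mem (F := C) (a := a) (b := b)
      have h₂ := fun a b => Above.mem (F := r) (a := a) (b := b)
      simp only [pruned, above_mul, Above, labels_mul, List.mem_append]
      grind

theorem above_trunk_iff {F : PlanarForest V} (hF : (labels F).Nodup) (c : AdmCut F) {a b : V} :
    Above (trunk F c) a b ↔ Above F a b ∧ a ∈ labels (trunk F c) := by
  induction F with
  | nil => simp [trunk, one_eq_nil, Above]
  | cons d C r ihC ihr =>
    obtain ⟨hdC, hdr, hC, hr, hCr⟩ := nodup_labels_cons.1 hF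
    rcases c with ⟨_ | k, s⟩
    · have h := ihr hr s
      have hs := fun b => (labels_trunk_sublist r s).subset (a := b)
      have h₁ := fun a b => Above.mem (F := C) (a := a) (b := b)
      have h₂ := fun a b => Above.mem (F := r) (a := a) (b := b)
      simp only [trunk, Above]
      grind
    · have h := ihr hr s
      have h' := ihC hC k
      have hs := fun b => (labels_trunk_sublist r s).subset (a := b)
      have hk := fun b => (labels_trunk_sublist C k).subset (a := b)
      have h₁ := fun a b => Above.mem (F := C) (a := a) (b := b)
      have h₂ := fun a b => Above.mem (F := r) (a := a) (b := b)
      simp only [trunk, graft_mul, Above, labels, List.mem_cons, List.mem_append]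
      grind

/-- Every upper set of the vertices is cut off by some admissible cut. -/
theorem exists_admCut_of_upper (F : PlanarForest V) (U : V → Prop)
    (hU : ∀ a b, Above F a b → U b → U a) :
    ∃ c : AdmCut F, (∀ a ∈ labels (pruned F c), U a) ∧ ∀ a ∈ labels (trunk F c), ¬ U a := by
  induction F with
  | nil => exact ⟨(), by simp [pruned, trunk, labels_one]⟩
  | cons d C r ihC ihr =>
    obtain ⟨s, hs, hs'⟩ := ihr fun a b h => hU a b (Or.inr (Or.inr h))
    by_cases hd : U d
    · refine ⟨(none, s), ?_, hs'⟩
      simp only [pruned, graft_mul, labels, List.mem_cons, List.mem_append]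
      rintro a (rfl | ha | ha)
      exacts [hd, hU a d (Or.inl ⟨rfl, ha⟩) hd, hs a ha]
    · obtain ⟨k, hk, hk'⟩ := ihC fun a b h => hU a b (Or.inr (Or.inl h))
      refine ⟨(some k, s), ?_, ?_⟩
      · simp only [pruned, labels_mul, List.mem_append]
        rintro a (ha | ha)
        exacts [hk a ha, hs a ha]
      · simp only [trunk, graft_mul, labels, List.mem_cons, List.mem_append]
        rintro a (rfl | ha | ha)
        exacts [hd, hk' a ha, hs' a ha]

/-- When the labels are distinct, an admissible cut is determined by the vertices it cuts off. -/
theorem admCut_ext {F : PlanarForest V} (hF : (labels F).Nodup) {c c' : AdmCut F}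
    (h : ∀ a, a ∈ labels (pruned F c) ↔ a ∈ labels (pruned F c')) : c = c' := by
  induction F with
  | nil => rfl
  | cons d C r ihC ihr =>
    obtain ⟨hdC, hdr, hC, hr, hCr⟩ := nodup_labels_cons.1 hF
    rcases c with ⟨o, s⟩
    rcases c' with ⟨o', s'⟩
    have hs := fun b => (labels_pruned_sublist r s).subset (a := b)
    have hs' := fun b => (labels_pruned_sublist r s').subset (a := b)
    have hss : s = s' := by
      refine ihr hr fun a => ?_
      have ha := h a
      rcases o with _ | k <;> rcases o' with _ | k'
      · simp only [pruned, graft_mul, labels, List.mem_cons, List.mem_append] at ha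
        grind
      · have hk := fun b => (labels_pruned_sublist C k').subset (a := b)
        simp only [pruned, graft_mul, labels_mul, labels, List.mem_cons, List.mem_append] at ha
        grind
      · have hk := fun b => (labels_pruned_sublist C k).subset (a := b)
        simp only [pruned, graft_mul, labels_mul, labels, List.mem_cons, List.mem_append] at ha
        grind
      · have hk := fun b => (labels_pruned_sublist C k).subset (a := b)
        have hk' := fun b => (labels_pruned_sublist C k').subset (a := b)
        simp only [pruned, labels_mul, List.mem_append] at ha
        grind
    subst hss
    suffices o = o' by rw [this]
    have hd := h d
    rcases o with _ | k <;> rcases o' with _ | k'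
    · rfl
    · have hk := fun b => (labels_pruned_sublist C k').subset (a := b)
      simp only [pruned, graft_mul, labels_mul, labels, List.mem_cons, List.mem_append] at hd
      grind
    · have hk := fun b => (labels_pruned_sublist C k).subset (a := b)
      simp only [pruned, graft_mul, labels_mul, labels, List.mem_cons, List.mem_append] at hd
      grind
    · have hk := fun b => (labels_pruned_sublist C k).subset (a := b)
      have hk' := fun b => (labels_pruned_sublist C k').subset (a := b)
      rw [ihC hC (c := k) (c' := k') fun a => ?_]
      have ha := h a
      simp only [pruned, labels_mul, List.mem_append] at ha
      grind

theorem append_mem_linWords {F : PlanarForest V} (hF : (labels F).Nodup) (c : AdmCut F)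
    {u v : List V} (hu : u ∈ linWords (pruned F c)) (hv : v ∈ linWords (trunk F c)) :
    u ++ v ∈ linWords F := by
  rw [mem_linWords] at *
  have hperm := labels_pruned_append_trunk_perm F c
  have hdisj := List.disjoint_of_nodup_append (hperm.nodup_iff.2 hF)
  refine ⟨(hu.1.append hv.1).trans hperm, List.pairwise_append.2 ⟨?_, ?_, ?_⟩⟩
  · refine hu.2.imp_of_mem fun {a b} ha hb h h' => h ((above_pruned_iff hF c).2 ⟨h', ?_⟩)
    exact hu.1.subset ha
  · refine hv.2.imp_of_mem fun {a b} ha hb h h' => h ((above_trunk_iff hF c).2 ⟨h', ?_⟩)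
    exact hv.1.subset hb
  · intro a ha b hb h
    have := (above_pruned_iff hF c).2 ⟨h, hu.1.subset ha⟩
    exact hdisj this.mem.1 (hv.1.subset hb)

theorem exists_admCut_of_append_mem {F : PlanarForest V} (hF : (labels F).Nodup)
    {u v : List V} (h : u ++ v ∈ linWords F) :
    ∃ c : AdmCut F, u ∈ linWords (pruned F c) ∧ v ∈ linWords (trunk F c) := by
  rw [mem_linWords] at h
  obtain ⟨hp, hpw⟩ := h
  obtain ⟨hpu, hpv, hpuv⟩ := List.pairwise_append.1 hpw
  have hnd := hp.nodup_iff.2 hF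
  have hdisj := List.disjoint_of_nodup_append hnd
  have hmem : ∀ a, a ∈ labels F ↔ a ∈ u ∨ a ∈ v := fun a => by
    rw [← hp.mem_iff, List.mem_append]
  obtain ⟨c, hc, hc'⟩ := exists_admCut_of_upper F (· ∈ u) fun a b hab hb => by
    rcases (hmem a).1 hab.mem.1 with ha | ha
    · exact ha
    · exact (hpuv b hb a ha hab).elim
  have hperm := labels_pruned_append_trunk_perm F c
  have hnd' := hperm.nodup_iff.2 hF
  have hmem' : ∀ a, a ∈ labels F ↔ a ∈ labels (pruned F c) ∨ a ∈ labels (trunk F c) := fun a => by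
    rw [← hperm.mem_iff, List.mem_append]
  refine ⟨c, mem_linWords.2 ⟨?_, ?_⟩, mem_linWords.2 ⟨?_, ?_⟩⟩
  · refine (List.perm_ext_iff_of_nodup hnd.of_append_left hnd'.of_append_left).2 fun a => ?_
    have := hmem a
    have := hmem' a
    have := hc a
    have := hc' a
    tauto
  · exact hpu.imp fun h h' => h ((above_pruned_iff hF c).1 h').1
  · refine (List.perm_ext_iff_of_nodup hnd.of_append_right hnd'.of_append_right).2 fun a => ?_
    have := hmem a
    have := hmem' a
    have := hc a
    have := hc' a
    have := @hdisj a
    tauto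
  · exact hpv.imp fun h h' => h ((above_trunk_iff hF c).1 h').1

/-- Cutting the linear extensions of `F` after the first `k` letters amounts to choosing an
admissible cut together with linear extensions of the two resulting forests. -/
theorem sum_linWords_take_drop {M : Type*} [AddCommMonoid M] {F : PlanarForest V}
    (hF : (labels F).Nodup) (k : ℕ) (φ : List V → List V → M)
    (hφ : ∀ u v, u.length ≠ k → φ u v = 0) :
    ∑ w ∈ linWords F, φ (w.take k) (w.drop k) =
      ∑ c : AdmCut F, ∑ u ∈ linWords (pruned F c), ∑ v ∈ linWords (trunk F c), φ u v := by
  classical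
  symm
  simp_rw [← Finset.sum_product', Finset.sum_sigma']
  rw [← Finset.sum_filter_of_ne (p := fun x => x.2.1.length = k)]
  swap
  · intro x _ hx
    by_contra h
    exact hx (hφ _ _ h)
  refine Finset.sum_of_injOn (fun x => x.2.1 ++ x.2.2) ?_ ?_ ?_ ?_
  · rintro ⟨c, u, v⟩ hx ⟨c', u', v'⟩ hx' h
    simp only [Finset.coe_filter, Finset.mem_sigma, Finset.mem_univ, true_and, Finset.mem_product,
      Set.mem_ofPred_eq] at hx hx'
    obtain ⟨rfl, rfl⟩ := List.append_inj h (hx.2.trans hx'.2.symm)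
    obtain rfl : c = c' := admCut_ext hF fun a => by
      rw [← (mem_linWords.1 hx.1.1).1.mem_iff, ← (mem_linWords.1 hx'.1.1).1.mem_iff]
    rfl
  · rintro ⟨c, u, v⟩ hx
    simp only [Finset.coe_filter, Finset.mem_sigma, Finset.mem_univ, true_and, Finset.mem_product,
      Set.mem_ofPred_eq] at hx
    exact append_mem_linWords hF c hx.1.1 hx.1.2
  · intro w hw hnot
    refine hφ _ _ fun hk => hnot ?_
    obtain ⟨c, hu, hv⟩ := exists_admCut_of_append_mem hF (u := w.take k) (v := w.drop k)
      (by rwa [List.take_append_drop])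
    exact ⟨⟨c, w.take k, w.drop k⟩, by simpa [hu, hv] using hk, List.take_append_drop _ _⟩
  · rintro ⟨c, u, v⟩ hx
    simp only [Finset.mem_filter] at hx
    simp [← hx.2]

end

/-! ### Forests labelled in increasing order -/

section

variable {V W : Type*}

/-- The forest obtained by applying `f` to the decorations. -/
def map (f : V → W) : PlanarForest V → PlanarForest W
  | nil => nil
  | cons d c r => cons (f d) (map f c) (map f r)

theorem map_mul (f : V → W) (F G : PlanarForest V) : map f (F * G) = map f F * map f G := by
  induction F with
  | nil => rfl
  | cons d c r _ ih => simp [cons_mul, map, ih]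

theorem map_graft (f : V → W) (d : V) (F : PlanarForest V) :
    map f (graft d F) = graft (f d) (map f F) := rfl

/-- Changing the decorations does not change the admissible cuts. -/
def admCutMap (f : V → W) : (F : PlanarForest V) → AdmCut F ≃ AdmCut (map f F)
  | nil => Equiv.refl Unit
  | cons _ c r => Equiv.prodCongr (Equiv.optionCongr (admCutMap f c)) (admCutMap f r)

theorem pruned_map (f : V → W) (F : PlanarForest V) (c : AdmCut F) :
    pruned (map f F) (admCutMap f F c) = map f (pruned F c) := by
  induction F with
  | nil => rfl
  | cons d C r ihC ihr =>
    rcases c with ⟨_ | k, s⟩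
    · simp only [pruned, map_mul, ← ihr]; rfl
    · simp only [pruned, map_mul, ← ihr, ← ihC]; rfl

theorem trunk_map (f : V → W) (F : PlanarForest V) (c : AdmCut F) :
    trunk (map f F) (admCutMap f F c) = map f (trunk F c) := by
  induction F with
  | nil => rfl
  | cons d C r ihC ihr =>
    rcases c with ⟨_ | k, s⟩
    · simp only [trunk, ← ihr]; rfl
    · simp only [trunk, map_mul, map_graft, ← ihr, ← ihC]; rfl

theorem cutsRight_map (f : V → W) (F : PlanarForest V) (c : AdmCut F) :
    CutsRight (map f F) (admCutMap f F c) ↔ CutsRight F c := by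
  induction F with
  | nil => rfl
  | cons d C r ihC ihr =>
    rcases c with ⟨o, s⟩
    cases r with
    | nil =>
      rcases o with _ | k
      · rfl
      · exact ihC k
    | cons d' C' r' => exact ihr s

variable {D : Type*}

/-- The keys of a forest increase from the root upwards and from left to right, in particular they
are pairwise distinct. -/
def IncreasingKeys (F : PlanarForest (ℕ × D)) : Prop :=
  (labels F).Pairwise fun a b => a.1 < b.1

theorem IncreasingKeys.nodup {F : PlanarForest (ℕ × D)} (hF : IncreasingKeys F) :
    (labels F).Nodup :=
  hF.imp fun h h' => by simp [h'] at h

theorem IncreasingKeys.pruned {F : PlanarForest (ℕ × D)} (hF : IncreasingKeys F) (c : AdmCut F) :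
    IncreasingKeys (pruned F c) :=
  List.Pairwise.sublist (labels_pruned_sublist F c) hF

theorem IncreasingKeys.trunk {F : PlanarForest (ℕ × D)} (hF : IncreasingKeys F) (c : AdmCut F) :
    IncreasingKeys (trunk F c) :=
  List.Pairwise.sublist (labels_trunk_sublist F c) hF

/-- The forest `F` with consecutive keys, starting with `n`, added to the decorations in the order
of the vertices from the root upwards and from left to right. -/
def addKeys : ℕ → PlanarForest D → PlanarForest (ℕ × D)
  | _, nil => nil
  | n, cons d c r => cons (n, d) (addKeys (n + 1) c) (addKeys (n + 1 + size c) r)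

theorem map_snd_addKeys (n : ℕ) (F : PlanarForest D) : map Prod.snd (addKeys n F) = F := by
  induction F generalizing n with
  | nil => rfl
  | cons d c r ihc ihr => simp [addKeys, map, ihc, ihr]

theorem mem_labels_addKeys {n : ℕ} {F : PlanarForest D} {a : ℕ × D} (h : a ∈ labels (addKeys n F)) :
    n ≤ a.1 ∧ a.1 < n + size F := by
  induction F generalizing n with
  | nil => simp [addKeys, labels] at h
  | cons d c r ihc ihr =>
    simp only [addKeys, labels, List.mem_cons, List.mem_append] at h
    rw [size]
    rcases h with rfl | h | h
    · exact ⟨le_rfl, by simp only; omega⟩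
    · have := ihc h; omega
    · have := ihr h; omega

theorem increasingKeys_addKeys (n : ℕ) (F : PlanarForest D) : IncreasingKeys (addKeys n F) := by
  induction F generalizing n with
  | nil => exact List.Pairwise.nil
  | cons d c r ihc ihr =>
    refine List.pairwise_cons.2 ⟨?_, List.pairwise_append.2 ⟨ihc _, ihr _, ?_⟩⟩
    · intro a ha
      rcases List.mem_append.1 ha with ha | ha
      · have := mem_labels_addKeys ha; simp only; omega
      · have := mem_labels_addKeys ha; simp only; omega
    · intro a ha b hb
      have := mem_labels_addKeys ha
      have := mem_labels_addKeys hb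
      omega

/-- The rightmost leaf of the last tree is the vertex with the largest key, and a cut goes to the
right exactly if it cuts off this vertex. -/
theorem cutsRight_iff_dominates {F : PlanarForest (ℕ × D)} (hF : IncreasingKeys F) (c : AdmCut F) :
    CutsRight F c ↔ Dominates (labels (pruned F c)) (labels (trunk F c)) := by
  induction F with
  | nil => simp [CutsRight, Dominates, pruned, labels_one]
  | cons d C r ihC ihr =>
    obtain ⟨hd, hF'⟩ := List.pairwise_cons.1 hF
    obtain ⟨hC, hr, hCr⟩ := List.pairwise_append.1 hF'
    rcases c with ⟨o, s⟩
    cases r with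
    | nil =>
      rcases o with _ | k
      · simp only [CutsRight, true_iff]
        exact ⟨d, by simp [pruned, labels_graft], by simp [trunk, labels_one]⟩
      · have hk := fun b => (labels_pruned_sublist C k).subset (a := b)
        simp only [CutsRight, ihC hC, Dominates, pruned, trunk, mul_one, labels_graft,
          List.mem_cons]
        refine exists_congr fun a => and_congr_right fun ha => ?_
        have := hd a (List.mem_append_left _ (hk a ha))
        grind
    | cons d' C' r' =>
      have hs := fun b => (labels_pruned_sublist _ s).subset (a := b)
      have hs' := fun b => (labels_trunk_sublist _ s).subset (a := b)
      have hperm := labels_pruned_append_trunk_perm _ s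
      obtain ⟨X, Y, hX, hY, hXd, hYd⟩ : ∃ X Y,
          labels (pruned (cons d C (cons d' C' r')) (o, s)) = X ++ labels (pruned _ s) ∧
          labels (trunk (cons d C (cons d' C' r')) (o, s)) = Y ++ labels (trunk _ s) ∧
          (∀ a ∈ X, a = d ∨ a ∈ labels C) ∧ ∀ a ∈ Y, a = d ∨ a ∈ labels C := by
        rcases o with _ | k
        · exact ⟨d :: labels C, [], by simp only [pruned, graft_mul, labels, List.cons_append],
            rfl, by simp, by simp⟩
        · exact ⟨labels (pruned C k), d :: labels (trunk C k),
            by simp only [pruned, labels_mul],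
            by simp only [trunk, graft_mul, labels, List.cons_append],
            fun a ha => Or.inr ((labels_pruned_sublist C k).subset ha),
            fun a ha => (List.mem_cons.1 ha).imp_right fun h =>
              (labels_trunk_sublist C k).subset h⟩
      have hlt : ∀ a b, a = d ∨ a ∈ labels C → b ∈ labels (cons d' C' r') → a.1 < b.1 := by
        rintro a b (rfl | ha) hb
        exacts [hd b (List.mem_append_right _ hb), hCr a ha b hb]
      rw [CutsRight, ihr hr, hX, hY]
      constructor
      · rintro ⟨a, ha, has⟩
        refine ⟨a, List.mem_append_right _ ha, fun b hb => ?_⟩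
        rcases List.mem_append.1 hb with hb | hb
        exacts [hlt b a (hYd b hb) (hs a ha), has b hb]
      · rintro ⟨a, ha, has⟩
        rcases List.mem_append.1 ha with ha | ha
        · -- Then nothing remains of the other trees, and all of them are cut off.
          have hT : ∀ b, b ∉ labels (trunk (cons d' C' r') s) := fun b hb =>
            (hlt a b (hXd a ha) (hs' b hb)).asymm (has b (List.mem_append_right _ hb))
          refine ⟨d', ?_, fun b hb => (hT b hb).elim⟩
          have hd' : d' ∈ labels (cons d' C' r') := by simp [labels]
          exact (List.mem_append.1 (hperm.mem_iff.2 hd')).resolve_right (hT d')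
        · exact ⟨a, ha, fun b hb => has b (List.mem_append_right _ hb)⟩

theorem Dominates.congr {u v u' v' : List (ℕ × D)} (hu : u.Perm u') (hv : v.Perm v') :
    Dominates u v ↔ Dominates u' v' := by
  simp only [Dominates, hu.mem_iff, hv.mem_iff]

/-! ### Counting linear extensions -/

variable (K : Type*) [Field K]

/-- The linear form on `H` that sums the evaluations on the linear extensions of `G`. -/
def evalLin (G : PlanarForest (ℕ × D)) : HAlg K D →ₗ[K] K := ∑ w ∈ linWords G, evalWord K w

variable {K}

theorem evalLin_apply (G : PlanarForest (ℕ × D)) (x : HAlg K D) :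
    evalLin K G x = ∑ w ∈ linWords G, evalWord K w x := by
  simp [evalLin]

theorem evalWord_ofForest_of_length_ne {w : List (ℕ × D)} {F : PlanarForest D}
    (h : w.length ≠ size F) : evalWord K w (ofForest K F) = 0 := by
  rw [evalWord_ofForest, if_neg fun hw => h hw.length_eq]

/-- Evaluating a product on the linear extensions of `G` gives a sum over all admissible cuts
of `G`. -/
theorem evalLin_mul {G : PlanarForest (ℕ × D)} (hG : IncreasingKeys G) (F₁ F₂ : PlanarForest D) :
    evalLin K G (ofForest K F₁ * ofForest K F₂) =
      ∑ c : AdmCut G, evalLin K (pruned G c) (ofForest K F₁) *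
        evalLin K (trunk G c) (ofForest K F₂) := by
  simp only [evalLin_apply, evalWord_mul, Finset.sum_mul_sum]
  exact sum_linWords_take_drop hG.nodup (size F₁)
    (fun u v => evalWord K u (ofForest K F₁) * evalWord K v (ofForest K F₂))
    fun u v h => by rw [evalWord_ofForest_of_length_ne h, zero_mul]

open Classical in
/-- Keeping only the words whose largest key is in the first part keeps the cuts that separate the
rightmost leaf of the last tree. -/
theorem evalLin_prec {G : PlanarForest (ℕ × D)} (hG : IncreasingKeys G) (F₁ F₂ : PlanarForest D) :
    evalLin K G (precForest K F₁ F₂) =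
      ∑ c : AdmCut G with CutsRight G c, evalLin K (pruned G c) (ofForest K F₁) *
        evalLin K (trunk G c) (ofForest K F₂) := by
  simp only [evalLin_apply, evalWord_precForest, Finset.sum_mul_sum]
  rw [sum_linWords_take_drop hG.nodup (size F₁) (fun u v => if Dominates u v then
    evalWord K u (ofForest K F₁) * evalWord K v (ofForest K F₂) else 0), Finset.sum_filter]
  · refine Finset.sum_congr rfl fun c _ => ?_
    have h : ∀ u ∈ linWords (pruned G c), ∀ v ∈ linWords (trunk G c),
        (Dominates u v ↔ CutsRight G c) := fun u hu v hv => by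
      rw [cutsRight_iff_dominates hG]
      exact Dominates.congr (mem_linWords.1 hu).1 (mem_linWords.1 hv).1
    by_cases hc : CutsRight G c
    · rw [if_pos hc]
      exact Finset.sum_congr rfl fun u hu => Finset.sum_congr rfl fun v hv =>
        if_pos ((h u hu v hv).2 hc)
    · rw [if_neg hc]
      exact Finset.sum_eq_zero fun u hu => Finset.sum_eq_zero fun v hv =>
        if_neg fun h' => hc ((h u hu v hv).1 h')
  · intro u v h
    rw [evalWord_ofForest_of_length_ne h, zero_mul, ite_self]

end

/-! ### Compatible bijections and linear extensions -/

section

variable {D V : Type*}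

/-- The vertices, from the root upwards and from left to right. -/
def vertices : (F : PlanarForest D) → List (Vertex F)
  | nil => []
  | cons _ c r => .root :: ((vertices c).map .above ++ (vertices r).map .rest)

theorem mem_vertices : ∀ {F : PlanarForest D} (x : Vertex F), x ∈ vertices F
  | cons _ _ _, .root => by simp [vertices]
  | cons _ _ _, .above x => by simp [vertices, mem_vertices x]
  | cons _ _ _, .rest x => by simp [vertices, mem_vertices x]

theorem length_vertices (F : PlanarForest D) : (vertices F).length = size F := by
  induction F with
  | nil => rfl
  | cons d c r ihc ihr => simp [vertices, size, ihc, ihr]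

theorem GeHigh.refl : ∀ {F : PlanarForest D} (x : Vertex F), GeHigh x x
  | cons _ _ _, .root => .root_root
  | cons _ _ _, .above x => .above_above (.refl x)
  | cons _ _ _, .rest x => .rest_rest (.refl x)

theorem geDL_above {d : D} {c r : PlanarForest D} {x y : Vertex c} :
    GeDL (F := cons d c r) (.above x) (.above y) ↔ GeDL x y := by
  constructor
  · rintro (h | h) <;> cases h
    exacts [Or.inl ‹_›, Or.inr ‹_›]
  · rintro (h | h)
    exacts [Or.inl (.above_above h), Or.inr (.above_above h)]

theorem geDL_rest {d : D} {c r : PlanarForest D} {x y : Vertex r} :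
    GeDL (F := cons d c r) (.rest x) (.rest y) ↔ GeDL x y := by
  constructor
  · rintro (h | h) <;> cases h
    exacts [Or.inl ‹_›, Or.inr ‹_›]
  · rintro (h | h)
    exacts [Or.inl (.rest_rest h), Or.inr (.rest_rest h)]

/-- The list of vertices is strictly decreasing for the total order `≥_{d,l}`. -/
theorem pairwise_vertices (F : PlanarForest D) :
    (vertices F).Pairwise fun x y => GeDL x y ∧ ¬ GeDL y x := by
  induction F with
  | nil => exact List.Pairwise.nil
  | cons d c r ihc ihr =>
    refine List.pairwise_cons.2 ⟨?_, List.pairwise_append.2 ⟨?_, ?_, ?_⟩⟩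
    · intro x hx
      cases x with
      | root => simp at hx
      | above x => exact ⟨Or.inr (.above_root x), by rintro (h | h) <;> cases h⟩
      | rest x => exact ⟨Or.inl (.root_rest x), by rintro (h | h) <;> cases h⟩
    · simpa only [List.pairwise_map, geDL_above] using ihc
    · simpa only [List.pairwise_map, geDL_rest] using ihr
    · intro x hx y hy
      obtain ⟨x, -, rfl⟩ := List.mem_map.1 hx
      obtain ⟨y, -, rfl⟩ := List.mem_map.1 hy
      exact ⟨Or.inl (.above_rest x y), by rintro (h | h) <;> cases h⟩

theorem eq_or_of_pairwise_vertices {F : PlanarForest D} {R : Vertex F → Vertex F → Prop}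
    (h : (vertices F).Pairwise R) (x y : Vertex F) : x = y ∨ R x y ∨ R y x := by
  have h' : (vertices F).Pairwise fun x y => x = y ∨ R x y ∨ R y x :=
    h.imp fun h => Or.inr (Or.inl h)
  have : Std.Symm fun x y => x = y ∨ R x y ∨ R y x := ⟨fun _ _ h => by tauto⟩
  exact List.Pairwise.forall_of_forall (R := fun x y => x = y ∨ R x y ∨ R y x)
    (fun _ _ => Or.inl rfl) h' (mem_vertices x) (mem_vertices y)

/-- The original decoration of a vertex of `map f F`. -/
def origDeco (f : V → D) : {F : PlanarForest V} → Vertex (map f F) → V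
  | cons d _ _, .root => d
  | cons _ _ _, .above x => origDeco f x
  | cons _ _ _, .rest x => origDeco f x

theorem apply_origDeco (f : V → D) :
    ∀ {F : PlanarForest V} (x : Vertex (map f F)), f (origDeco f x) = x.deco
  | cons _ _ _, .root => rfl
  | cons _ _ _, .above x => apply_origDeco f (F := _) x
  | cons _ _ _, .rest x => apply_origDeco f (F := _) x

theorem map_origDeco_vertices (f : V → D) (F : PlanarForest V) :
    (vertices (map f F)).map (origDeco f) = labels F := by
  induction F with
  | nil => rfl
  | cons d c r ihc ihr =>
    rw [labels, ← ihc, ← ihr]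
    have h (g : Vertex (cons (f d) (map f c) (map f r)) → V) :
        (vertices (cons (f d) (map f c) (map f r))).map g = g .root ::
          ((vertices (map f c)).map (g ∘ .above) ++ (vertices (map f r)).map (g ∘ .rest)) := by
      simp only [vertices, List.map_cons, List.map_append, List.map_map]
    exact h (origDeco f (F := cons d c r))

theorem mem_labels_iff {f : V → D} {F : PlanarForest V} {a : V} :
    a ∈ labels F ↔ ∃ x : Vertex (map f F), origDeco f x = a := by
  rw [← map_origDeco_vertices f, List.mem_map]
  exact ⟨fun ⟨x, _, h⟩ => ⟨x, h⟩, fun ⟨x, h⟩ => ⟨x, mem_vertices x, h⟩⟩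

theorem above_iff {f : V → D} {F : PlanarForest V} {a b : V} :
    Above F a b ↔ ∃ x y : Vertex (map f F),
      GeHigh x y ∧ x ≠ y ∧ origDeco f x = a ∧ origDeco f y = b := by
  induction F with
  | nil => exact ⟨False.elim, fun ⟨x, _⟩ => nomatch x⟩
  | cons d c r ihc ihr =>
    rw [Above, ihc, ihr, mem_labels_iff (f := f)]
    constructor
    · rintro (⟨rfl, x, rfl⟩ | ⟨x, y, h, hne, rfl, rfl⟩ | ⟨x, y, h, hne, rfl, rfl⟩)
      · exact ⟨.above x, .root, .above_root x, nofun, rfl, rfl⟩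
      · exact ⟨.above x, .above y, .above_above h, fun h => hne (Vertex.above.inj h), rfl, rfl⟩
      · exact ⟨.rest x, .rest y, .rest_rest h, fun h => hne (Vertex.rest.inj h), rfl, rfl⟩
    · rintro ⟨x, y, h, hne, rfl, rfl⟩
      rcases h with _ | x | h | h
      · exact (hne rfl).elim
      · exact Or.inl ⟨rfl, x, rfl⟩
      · exact Or.inr (Or.inl ⟨_, _, h, fun h => hne (congrArg _ h), rfl, rfl⟩)
      · exact Or.inr (Or.inr ⟨_, _, h, fun h => hne (congrArg _ h), rfl, rfl⟩)

/-- In terms of the letters `g x` put on the vertices, a word matches `F` if the keys decrease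
upwards and the decorations agree. -/
theorem matches_map_vertices {F : PlanarForest D} {g : Vertex F → ℕ × D} :
    Matches F ((vertices F).map g) ↔
      (∀ x y, GeHigh x y → x = y ∨ (g x).1 < (g y).1) ∧ ∀ x, x.deco = (g x).2 := by
  induction F with
  | nil => exact ⟨fun _ => ⟨nofun, nofun⟩, fun _ => rfl⟩
  | cons d c r ihc ihr =>
    have key : Matches (cons d c r) ((vertices (cons d c r)).map g) ↔
        (g .root).2 = d ∧ (∀ x, (g (.above x)).1 < (g .root).1) ∧
          Matches c ((vertices c).map (g ∘ .above)) ∧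
          Matches r ((vertices r).map (g ∘ .rest)) := by
      constructor
      · rintro ⟨a, u, v, h, ha, hau, hu, hv⟩
        simp only [vertices, List.map_cons, List.map_append, List.map_map] at h
        obtain ⟨rfl, h'⟩ := List.cons.inj h
        obtain ⟨rfl, rfl⟩ := List.append_inj h' (by
          rw [List.length_map, length_vertices, hu.length_eq])
        exact ⟨ha, fun x => hau _ (List.mem_map.2 ⟨x, mem_vertices x, rfl⟩), hu, hv⟩
      · rintro ⟨ha, hau, hu, hv⟩
        refine ⟨_, _, _, ?_, ha, ?_, hu, hv⟩
        · simp only [vertices, List.map_cons, List.map_append, List.map_map]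
        · intro b hb
          obtain ⟨x, -, rfl⟩ := List.mem_map.1 hb
          exact hau x
    rw [key, ihc, ihr]
    constructor
    · rintro ⟨ha, hau, ⟨hc, hc'⟩, hr, hr'⟩
      constructor
      · intro x y h
        rcases h with _ | x | h | h
        · exact Or.inl rfl
        · exact Or.inr (hau x)
        · exact (hc _ _ h).imp_left (congrArg _)
        · exact (hr _ _ h).imp_left (congrArg _)
      · rintro (_ | x | x)
        exacts [ha.symm, hc' x, hr' x]
    · rintro ⟨h, h'⟩
      exact ⟨(h' .root).symm, fun x => (h _ _ (.above_root x)).resolve_left nofun,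
        ⟨fun x y hxy => (h _ _ (.above_above hxy)).imp_left Vertex.above.inj,
          fun x => h' (.above x)⟩,
        fun x y hxy => (h _ _ (.rest_rest hxy)).imp_left Vertex.rest.inj,
          fun x => h' (.rest x)⟩

theorem Matches.exists_eq_map {F : PlanarForest D} {w : List (ℕ × D)} (h : Matches F w) :
    ∃ g : Vertex F → ℕ × D, w = (vertices F).map g := by
  induction F generalizing w with
  | nil => exact ⟨nofun, h⟩
  | cons d c r ihc ihr =>
    obtain ⟨a, u, v, rfl, -, -, hu, hv⟩ := h
    obtain ⟨g, rfl⟩ := ihc hu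
    obtain ⟨g', rfl⟩ := ihr hv
    refine ⟨fun x => match x with
      | .root => a
      | .above x => g x
      | .rest x => g' x, ?_⟩
    simp only [vertices, List.map_cons, List.map_append, List.map_map]
    rfl

/-- The word attached to a bijection onto the vertices of a forest with increasing keys: the image
of the list of vertices. -/
def wordOf {F : PlanarForest D} {G : PlanarForest (ℕ × D)}
    (f : Vertex F ≃ Vertex (map Prod.snd G)) : List (ℕ × D) :=
  (vertices F).map fun x => origDeco Prod.snd (f x)

theorem IncreasingKeys.origDeco_injective {G : PlanarForest (ℕ × D)} (hG : IncreasingKeys G) :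
    Function.Injective (origDeco Prod.snd : Vertex (map Prod.snd G) → ℕ × D) := by
  have h := hG.nodup
  rw [← map_origDeco_vertices Prod.snd] at h
  exact fun x y hxy => List.inj_on_of_nodup_map h (mem_vertices x) (mem_vertices y) hxy

theorem IncreasingKeys.geDL_iff {G : PlanarForest (ℕ × D)} (hG : IncreasingKeys G)
    (x y : Vertex (map Prod.snd G)) :
    GeDL x y ↔ x = y ∨ (origDeco Prod.snd x).1 < (origDeco Prod.snd y).1 := by
  have h : (vertices (map Prod.snd G)).Pairwise fun x y =>
      (origDeco Prod.snd x).1 < (origDeco Prod.snd y).1 := by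
    rw [IncreasingKeys, ← map_origDeco_vertices Prod.snd, List.pairwise_map] at hG
    exact hG
  rcases eq_or_of_pairwise_vertices (h.and (pairwise_vertices _)) x y with
    rfl | ⟨h₁, h₂, h₃⟩ | ⟨h₁, h₂, h₃⟩
  · exact iff_of_true (Or.inr (.refl x)) (Or.inl rfl)
  · exact iff_of_true h₂ (Or.inr h₁)
  · refine iff_of_false h₃ ?_
    rintro (rfl | h)
    exacts [h₁.false, h₁.asymm h]

theorem IncreasingKeys.above_origDeco_iff {G : PlanarForest (ℕ × D)} (hG : IncreasingKeys G)
    (x y : Vertex (map Prod.snd G)) :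
    Above G (origDeco Prod.snd x) (origDeco Prod.snd y) ↔ GeHigh x y ∧ x ≠ y := by
  rw [above_iff (f := Prod.snd)]
  constructor
  · rintro ⟨x', y', h, hne, hx, hy⟩
    rw [← hG.origDeco_injective hx, ← hG.origDeco_injective hy]
    exact ⟨h, hne⟩
  · rintro ⟨h, hne⟩
    exact ⟨x, y, h, hne, rfl, rfl⟩

/-- The first and the third condition on a compatible bijection say that its word matches `F`, and
the second one says that its word is a linear extension of `G`. -/
theorem mem_compatBij_iff {F : PlanarForest D} {G : PlanarForest (ℕ × D)} (hG : IncreasingKeys G)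
    (f : Vertex F ≃ Vertex (map Prod.snd G)) :
    f ∈ compatBij F (map Prod.snd G) ↔ wordOf f ∈ linWords G ∧ Matches F (wordOf f) := by
  have hperm : (wordOf f).Perm (labels G) := by
    have hnd : ∀ F : PlanarForest D, (vertices F).Nodup := fun F =>
      (pairwise_vertices F).imp fun h h' => by subst h'; exact h.2 h.1
    have : ((vertices F).map f).Perm (vertices (map Prod.snd G)) :=
      (List.perm_ext_iff_of_nodup ((hnd _).map f.injective) (hnd _)).2 fun y =>
        iff_of_true (List.mem_map.2 ⟨f.symm y, mem_vertices _, by simp⟩) (mem_vertices y)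
    simpa [wordOf, ← map_origDeco_vertices Prod.snd, Function.comp_def] using
      this.map (origDeco Prod.snd)
  have h₂ : (∀ x y, GeHigh (f x) (f y) → GeDL x y) ↔
      (wordOf f).Pairwise fun a b => ¬ Above G b a := by
    rw [wordOf, List.pairwise_map]
    simp only [hG.above_origDeco_iff]
    constructor
    · intro h
      refine (pairwise_vertices F).imp fun hxy h' => hxy.2 (h _ _ h'.1)
    · intro h x y hxy
      rcases eq_or_of_pairwise_vertices (h.and (pairwise_vertices F)) x y with
        rfl | h | ⟨h₁, h₂, h₃⟩
      · exact Or.inr (.refl x)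
      · exact h.2.1
      · refine (h₁ ⟨hxy, fun h => h₃ ?_⟩).elim
        rw [f.injective h]
        exact Or.inr (.refl y)
  rw [mem_linWords, and_iff_right hperm, ← h₂, wordOf, matches_map_vertices]
  simp only [compatBij, Set.mem_ofPred_eq, hG.geDL_iff, f.injective.eq_iff, apply_origDeco]
  tauto

theorem evalLin_eq_card {G : PlanarForest (ℕ × D)} (hG : IncreasingKeys G) (K : Type*) [Field K]
    (F : PlanarForest D) :
    evalLin K G (ofForest K F) = (Nat.card (compatBij F (map Prod.snd G)) : K) := by
  classical
  rw [evalLin_apply]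
  simp only [evalWord_ofForest, Finset.sum_boole]
  congr 1
  rw [← Fintype.card_coe, ← Nat.card_eq_fintype_card]
  refine (Nat.card_eq_of_bijective (fun f : compatBij F (map Prod.snd G) =>
    (⟨wordOf f.1, by simpa using (mem_compatBij_iff hG f.1).1 f.2⟩ :
      {w // w ∈ (linWords G).filter (Matches F)})) ⟨?_, ?_⟩).symm
  · intro f f' h
    have h := congrArg Subtype.val h
    refine Subtype.ext (Equiv.ext fun x => hG.origDeco_injective ?_)
    exact List.map_inj_left.1 h x (mem_vertices x)
  · rintro ⟨w, hw⟩
    obtain ⟨hlin, hm⟩ := Finset.mem_filter.1 hw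
    obtain ⟨g, rfl⟩ := hm.exists_eq_map
    have hperm := (mem_linWords.1 hlin).1
    have hg : Function.Injective g := fun x y hxy =>
      List.inj_on_of_nodup_map (hperm.nodup_iff.2 hG.nodup) (mem_vertices x) (mem_vertices y) hxy
    have hex : ∀ x, ∃ y : Vertex (map Prod.snd G), origDeco Prod.snd y = g x := fun x =>
      mem_labels_iff.1 (hperm.mem_iff.1 (List.mem_map.2 ⟨x, mem_vertices x, rfl⟩))
    choose f hf using hex
    have hbij : Function.Bijective f := by
      constructor
      · intro x y hxy
        exact hg (by rw [← hf, ← hf, hxy])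
      · intro y
        obtain ⟨x, -, hx⟩ := List.mem_map.1 (hperm.mem_iff.2 (mem_labels_iff.2 ⟨y, rfl⟩))
        exact ⟨x, hG.origDeco_injective ((hf x).trans hx)⟩
    have hword : wordOf (Equiv.ofBijective f hbij) = (vertices F).map g :=
      List.map_congr_left fun x _ => hf x
    exact ⟨⟨Equiv.ofBijective f hbij, (mem_compatBij_iff hG _).2 (by rw [hword]; exact ⟨hlin, hm⟩)⟩,
      Subtype.ext hword⟩

end

/-! ### The pairing given by compatible bijections -/

section

variable {D : Type*} {K : Type*} [Field K]

variable (K) in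
/-- The bilinear form that counts compatible bijections. -/
def countForm : LinearMap.BilinForm K (HAlg K D) :=
  extend K fun F => extend K fun G => (Nat.card (compatBij F G) : K)

theorem countForm_ofForest (F G : PlanarForest D) :
    countForm K (ofForest K F) (ofForest K G) = Nat.card (compatBij F G) := by
  simp [countForm]

theorem card_compatBij_comm (F G : PlanarForest D) :
    Nat.card (compatBij F G) = Nat.card (compatBij G F) := by
  have h : ∀ {F G : PlanarForest D} {f : Vertex F ≃ Vertex G}, f ∈ compatBij F G →
      f.symm ∈ compatBij G F := by
    rintro F G f ⟨h₁, h₂, h₃⟩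
    exact ⟨fun x y h => h₂ _ _ (by simpa using h), fun x y h => by simpa using h₁ _ _ h,
      fun x => by simpa using (h₃ (f.symm x)).symm⟩
  exact Nat.card_congr ⟨fun f => ⟨f.1.symm, h f.2⟩, fun f => ⟨f.1.symm, h f.2⟩, fun _ => rfl,
    fun _ => rfl⟩

theorem countForm_isSymm :
    LinearMap.IsSymm (countForm K : LinearMap.BilinForm K (HAlg K D)) := by
  refine ⟨fun x y => ?_⟩
  have : countForm K = LinearMap.flip (countForm K : LinearMap.BilinForm K (HAlg K D)) :=
    hAlg_hom_ext fun F => hAlg_hom_ext fun G => by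
      rw [LinearMap.flip_apply, countForm_ofForest, countForm_ofForest, card_compatBij_comm]
  exact LinearMap.congr_fun₂ this x y

theorem countForm_map_snd {G : PlanarForest (ℕ × D)} (hG : IncreasingKeys G) (x : HAlg K D) :
    countForm K x (ofForest K (map Prod.snd G)) = evalLin K G x := by
  have : LinearMap.flip (countForm K) (ofForest K (map Prod.snd G)) = evalLin K G :=
    hAlg_hom_ext fun F => by
      rw [LinearMap.flip_apply, countForm_ofForest, evalLin_eq_card hG]
  exact LinearMap.congr_fun this x

theorem countForm_mul (F₁ F₂ G : PlanarForest D) :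
    countForm K (ofForest K F₁ * ofForest K F₂) (ofForest K G) =
      ∑ c : AdmCut G, countForm K (ofForest K F₁) (ofForest K (pruned G c)) *
        countForm K (ofForest K F₂) (ofForest K (trunk G c)) := by
  have hG := increasingKeys_addKeys 0 G
  rw [← map_snd_addKeys 0 G]
  generalize addKeys 0 G = G at hG
  rw [countForm_map_snd hG, evalLin_mul hG, ← (admCutMap Prod.snd G).sum_comp]
  simp only [pruned_map, trunk_map, countForm_map_snd (hG.pruned _), countForm_map_snd (hG.trunk _)]

open Classical in
theorem countForm_precForest (F₁ F₂ G : PlanarForest D) :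
    countForm K (precForest K F₁ F₂) (ofForest K G) =
      ∑ c : AdmCut G with CutsRight G c, countForm K (ofForest K F₁) (ofForest K (pruned G c)) *
        countForm K (ofForest K F₂) (ofForest K (trunk G c)) := by
  have hG := increasingKeys_addKeys 0 G
  rw [← map_snd_addKeys 0 G]
  generalize addKeys 0 G = G at hG
  rw [countForm_map_snd hG, evalLin_prec hG, Finset.sum_filter, Finset.sum_filter,
    ← (admCutMap Prod.snd G).sum_comp]
  simp only [pruned_map, trunk_map, cutsRight_map, countForm_map_snd (hG.pruned _),
    countForm_map_snd (hG.trunk _)]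

theorem card_compatBij_one_left {G : PlanarForest D} (hG : G ≠ 1) :
    Nat.card (compatBij 1 G) = 0 := by
  rw [Nat.card_eq_zero]
  left
  cases G with
  | nil => exact (hG rfl).elim
  | cons d c r => exact ⟨fun f => nomatch f.1.symm .root⟩

theorem card_compatBij_one_one : Nat.card (compatBij (1 : PlanarForest D) 1) = 1 := by
  have : IsEmpty (Vertex (1 : PlanarForest D)) := ⟨nofun⟩
  rw [Nat.card_eq_one_iff_unique]
  exact ⟨⟨fun f g => Subtype.ext (Equiv.ext fun x => isEmptyElim x)⟩,
    ⟨Equiv.refl _, fun x => isEmptyElim x, fun x => isEmptyElim x, fun x => isEmptyElim x⟩⟩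

theorem countForm_one_left (y : HAlg K D) : countForm K 1 y = counit K y := by
  have : countForm K (ofForest K 1) = counit K (D := D) := hAlg_hom_ext fun G => by
    rw [countForm_ofForest, counit, extend_ofForest]
    split_ifs with h
    · subst h; rw [card_compatBij_one_one, Nat.cast_one]
    · simp [card_compatBij_one_left h]
  exact LinearMap.congr_fun this y

open Classical in
theorem card_compatBij_dot (d d' : D) :
    Nat.card (compatBij (graft d 1) (graft d' 1)) = if d = d' then 1 else 0 := by
  have hV : ∀ d (x : Vertex (graft d (1 : PlanarForest D))), x = .root := fun d x =>
    match x with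
    | .root => rfl
  have hU (d : D) : Unique (Vertex (graft d (1 : PlanarForest D))) := ⟨⟨.root⟩, hV d⟩
  split_ifs with h
  · subst h
    rw [Nat.card_eq_one_iff_unique]
    refine ⟨⟨fun f g => Subtype.ext (Equiv.ext fun x => (hV _ _).trans (hV _ _).symm)⟩,
      ⟨Equiv.refl _, fun x y _ => ?_, fun x y _ => ?_, fun _ => rfl⟩⟩
    · rw [hV _ x, hV _ y]; exact Or.inr (.refl _)
    · rw [hV _ x, hV _ y]; exact Or.inr (.refl _)
  · rw [Nat.card_eq_zero]
    refine Or.inl ⟨fun f => h ?_⟩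
    have := f.2.2.2 .root
    rw [hV _ (f.1 .root)] at this
    exact this

/-! ### Bidendriform identities on the augmentation ideal -/

theorem ofForest_mem_augIdeal {F : PlanarForest D} (hF : F ≠ 1) : ofForest K F ∈ augIdeal K D := by
  simp [augIdeal, counit, hF]

theorem dot_mem_augIdeal (d : D) : dot K d ∈ augIdeal K D :=
  ofForest_mem_augIdeal nofun

theorem augIdeal_hom_ext {M : Type*} [AddCommGroup M] [Module K M] {f g : HAlg K D →ₗ[K] M}
    (h : ∀ F, F ≠ 1 → f (ofForest K F) = g (ofForest K F)) {x : HAlg K D}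
    (hx : x ∈ augIdeal K D) : f x = g x := by
  -- The map `f - g` vanishes on nonempty forests, so it is `ε` times its value at `1`.
  have key : f - g = (counit K).smulRight ((f - g) (ofForest K 1)) := hAlg_hom_ext fun F => by
    by_cases hF : F = 1
    · subst hF; simp [counit]
    · simp [counit, hF, h F hF]
  have := LinearMap.congr_fun key x
  rw [LinearMap.smulRight_apply, show counit K x = 0 from hx, zero_smul] at this
  exact sub_eq_zero.1 this

/-- It suffices to check a bidendriform identity on nonempty forests. -/
theorem eq_tensorForm_of_forests {p : LinearMap.BilinForm K (HAlg K D)}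
    {op : HAlg K D →ₗ[K] HAlg K D →ₗ[K] HAlg K D} {Δ : HAlg K D →ₗ[K] HAlg K D ⊗[K] HAlg K D}
    (h : ∀ F₁ F₂ G : PlanarForest D, F₁ ≠ 1 → F₂ ≠ 1 → G ≠ 1 →
      p (op (ofForest K F₁) (ofForest K F₂)) (ofForest K G) =
        tensorForm p (ofForest K F₁ ⊗ₜ ofForest K F₂) (Δ (ofForest K G)))
    {a₁ a₂ b : HAlg K D} (h₁ : a₁ ∈ augIdeal K D) (h₂ : a₂ ∈ augIdeal K D)
    (hb : b ∈ augIdeal K D) : p (op a₁ a₂) b = tensorForm p (a₁ ⊗ₜ a₂) (Δ b) := by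
  refine augIdeal_hom_ext (f := p (op a₁ a₂)) (g := tensorForm p (a₁ ⊗ₜ a₂) ∘ₗ Δ)
    (fun G hG => ?_) hb
  refine augIdeal_hom_ext (f := p.flip (ofForest K G) ∘ₗ op.flip a₂)
    (g := (tensorForm p).flip (Δ (ofForest K G)) ∘ₗ (TensorProduct.mk K _ _).flip a₂)
    (fun F₁ hF₁ => ?_) h₁
  exact augIdeal_hom_ext (f := p.flip (ofForest K G) ∘ₗ op (ofForest K F₁))
    (g := (tensorForm p).flip (Δ (ofForest K G)) ∘ₗ TensorProduct.mk K _ _ (ofForest K F₁))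
    (fun F₂ hF₂ => h F₁ F₂ G hF₁ hF₂ hG) h₂

theorem tensorForm_tmul (p : LinearMap.BilinForm K (HAlg K D)) (x y x' y' : HAlg K D) :
    tensorForm p (x ⊗ₜ y) (x' ⊗ₜ y') = p x x' * p y y' := by
  simp [tensorForm, mul_comm]

open Classical in
theorem tensorForm_deltaPrec (p : LinearMap.BilinForm K (HAlg K D)) (x y : HAlg K D)
    (G : PlanarForest D) :
    tensorForm p (x ⊗ₜ y) (deltaPrec K (ofForest K G)) =
      ∑ c : AdmCut G with CutsRight G c ∧ trunk G c ≠ 1,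
        p x (ofForest K (pruned G c)) * p y (ofForest K (trunk G c)) := by
  simp only [deltaPrec, extend_ofForest, map_sum, tensorForm_tmul]

open Classical in
theorem tensorForm_deltaSucc (p : LinearMap.BilinForm K (HAlg K D)) (x y : HAlg K D)
    (G : PlanarForest D) :
    tensorForm p (x ⊗ₜ y) (deltaSucc K (ofForest K G)) =
      ∑ c : AdmCut G with ¬ CutsRight G c ∧ pruned G c ≠ 1,
        p x (ofForest K (pruned G c)) * p y (ofForest K (trunk G c)) := by
  simp only [deltaSucc, extend_ofForest, map_sum, tensorForm_tmul]

theorem prec_ofForest (F G : PlanarForest D) :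
    prec K (ofForest K F) (ofForest K G) = precForest K F G := by
  simp [prec]

theorem prec_add_succ (x y : HAlg K D) : prec K x y + succ K x y = x * y := by
  simp [succ]

theorem countForm_ofForest_one {F : PlanarForest D} (hF : F ≠ 1) :
    countForm K (ofForest K F) (ofForest K 1) = 0 := by
  rw [countForm_ofForest, card_compatBij_comm, card_compatBij_one_left hF, Nat.cast_zero]

theorem countForm_prec {a₁ a₂ b : HAlg K D} (h₁ : a₁ ∈ augIdeal K D) (h₂ : a₂ ∈ augIdeal K D)
    (hb : b ∈ augIdeal K D) :
    countForm K (prec K a₁ a₂) b = tensorForm (countForm K) (a₁ ⊗ₜ a₂) (deltaPrec K b) := by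
  classical
  refine eq_tensorForm_of_forests (fun F₁ F₂ G _ hF₂ _ => ?_) h₁ h₂ hb
  rw [prec_ofForest, countForm_precForest, tensorForm_deltaPrec, ← Finset.filter_filter]
  refine (Finset.sum_filter_of_ne (p := fun c => trunk G c ≠ 1) fun c _ hc h => hc ?_).symm
  rw [h, countForm_ofForest_one hF₂, mul_zero]

theorem countForm_succ {a₁ a₂ b : HAlg K D} (h₁ : a₁ ∈ augIdeal K D) (h₂ : a₂ ∈ augIdeal K D)
    (hb : b ∈ augIdeal K D) :
    countForm K (succ K a₁ a₂) b = tensorForm (countForm K) (a₁ ⊗ₜ a₂) (deltaSucc K b) := by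
  classical
  refine eq_tensorForm_of_forests (fun F₁ F₂ G hF₁ _ _ => ?_) h₁ h₂ hb
  rw [eq_sub_of_add_eq' (prec_add_succ (ofForest K F₁) (ofForest K F₂)), map_sub,
    LinearMap.sub_apply, prec_ofForest, countForm_mul, countForm_precForest, tensorForm_deltaSucc,
    sub_eq_iff_eq_add', ← Finset.sum_filter_add_sum_filter_not _ (CutsRight G),
    ← Finset.filter_filter]
  congr 1
  refine (Finset.sum_filter_of_ne (p := fun c => pruned G c ≠ 1) fun c _ hc h => hc ?_).symm
  rw [h, countForm_ofForest_one hF₁, zero_mul]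

theorem countForm_isForestPairing :
    IsForestPairing (countForm K : LinearMap.BilinForm K (HAlg K D)) := by
  have hsymm : ∀ x y : HAlg K D, countForm K x y = countForm K y x := countForm_isSymm.eq
  have hsymm' : ∀ x y : HAlg K D ⊗[K] HAlg K D,
      tensorForm (countForm K) x y = tensorForm (countForm K) y x :=
    (LinearMap.IsSymm.tmul countForm_isSymm countForm_isSymm).eq
  refine ⟨⟨?_, ?_, ?_, ?_⟩, ?_, countForm_one_left, fun x => ?_⟩
  · exact fun a₁ h₁ a₂ h₂ b hb => countForm_prec h₁ h₂ hb
  · exact fun a₁ h₁ a₂ h₂ b hb => countForm_succ h₁ h₂ hb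
  · intro a ha b₁ h₁ b₂ h₂
    rw [hsymm, hsymm', countForm_prec h₁ h₂ ha]
  · intro a ha b₁ h₁ b₂ h₂
    rw [hsymm, hsymm', countForm_succ h₁ h₂ ha]
  · intro d d'
    rw [dot, dot, countForm_ofForest, card_compatBij_dot]
    split_ifs <;> simp
  · rw [hsymm, countForm_one_left]

/-! ### Uniqueness of the pairing -/

theorem size_pos {F : PlanarForest D} (hF : F ≠ 1) : 0 < size F := by
  cases F with
  | nil => exact (hF rfl).elim
  | cons => rw [size]; omega

/-- The single vertices generate the augmentation ideal as a dendriform algebra: a tree with several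
vertices is a product `• ≺ F`, and a forest with several trees is a product of forests. -/
theorem exists_dendriform_decomposition {F : PlanarForest D} (hF : F ≠ 1) :
    (∃ d, F = graft d 1) ∨ ∃ F₁ F₂ : PlanarForest D, F₁ ≠ 1 ∧ F₂ ≠ 1 ∧
      size F₁ < size F ∧ size F₂ < size F ∧
      (ofForest K F = prec K (ofForest K F₁) (ofForest K F₂) ∨
        ofForest K F = prec K (ofForest K F₁) (ofForest K F₂) +
          succ K (ofForest K F₁) (ofForest K F₂)) := by
  cases F with
  | nil => exact (hF rfl).elim
  | cons d c r =>
    by_cases hr : r = 1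
    · subst hr
      by_cases hc : c = 1
      · exact Or.inl ⟨d, by rw [hc]; rfl⟩
      · have hs := size_pos hc
        refine Or.inr ⟨graft d 1, c, nofun, hc, ?_, ?_, Or.inl ?_⟩
        · simp only [graft, size, one_eq_nil]; omega
        · simp only [size]; omega
        · rw [prec_ofForest, graft, precForest]
          simp [one_eq_nil, precForest, nil_mul, graft]
    · have hs := size_pos hr
      refine Or.inr ⟨graft d c, r, nofun, hr, ?_, ?_, Or.inr ?_⟩
      · rw [size_graft, size]; omega
      · rw [size]; omega
      · rw [prec_add_succ, ofForest_mul, graft_mul]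

theorem deltaPrec_dot (d : D) : deltaPrec K (dot K d) = 0 := by
  classical
  rw [dot, deltaPrec, extend_ofForest, Finset.filter_false_of_mem, Finset.sum_empty]
  rintro ⟨_ | k, s⟩ - ⟨h, h'⟩
  exacts [h' rfl, h]

theorem deltaSucc_dot (d : D) : deltaSucc K (dot K d) = 0 := by
  classical
  rw [dot, deltaSucc, extend_ofForest, Finset.filter_false_of_mem, Finset.sum_empty]
  rintro ⟨_ | k, s⟩ - ⟨h, h'⟩
  exacts [h trivial, h' rfl]

open Classical in
theorem IsForestPairing.dot_ofForest {p : LinearMap.BilinForm K (HAlg K D)}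
    (hp : IsForestPairing p) (d : D) {G : PlanarForest D} (hG : G ≠ 1) :
    p (dot K d) (ofForest K G) = if G = graft d 1 then 1 else 0 := by
  rcases exists_dendriform_decomposition (K := K) hG with
    ⟨d', rfl⟩ | ⟨G₁, G₂, h₁, h₂, hs₁, hs₂, h⟩
  · rw [← dot, hp.dot_dot]
    simp [graft, eq_comm]
  · have hne : G ≠ graft d 1 := by
      rintro rfl
      have := size_pos h₁
      simp only [size_graft, size, one_eq_nil] at hs₁
      omega
    have hd := dot_mem_augIdeal (K := K) d
    have h₁ := ofForest_mem_augIdeal (K := K) h₁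
    have h₂ := ofForest_mem_augIdeal (K := K) h₂
    rw [if_neg hne]
    rcases h with h | h
    · rw [h, hp.prec_right _ hd _ h₁ _ h₂, deltaPrec_dot]
      simp
    · rw [h, map_add, hp.prec_right _ hd _ h₁ _ h₂, hp.succ_right _ hd _ h₁ _ h₂, deltaPrec_dot,
        deltaSucc_dot]
      simp

theorem IsForestPairing.ofForest_eq {p q : LinearMap.BilinForm K (HAlg K D)}
    (hp : IsForestPairing p) (hq : IsForestPairing q) (F G : PlanarForest D) :
    p (ofForest K F) (ofForest K G) = q (ofForest K F) (ofForest K G) := by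
  classical
  induction hn : size F using Nat.strong_induction_on generalizing F G with
  | _ n ih =>
  subst hn
  by_cases hF : F = 1
  · subst hF
    exact (hp.one_left _).trans (hq.one_left _).symm
  by_cases hG : G = 1
  · subst hG
    exact (hp.one_right _).trans (hq.one_right _).symm
  rcases exists_dendriform_decomposition (K := K) hF with
    ⟨d, rfl⟩ | ⟨F₁, F₂, h₁, h₂, hs₁, hs₂, h⟩
  · exact (hp.dot_ofForest d hG).trans (hq.dot_ofForest d hG).symm
  · have h₁ := ofForest_mem_augIdeal (K := K) h₁
    have h₂ := ofForest_mem_augIdeal (K := K) h₂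
    have hG := ofForest_mem_augIdeal (K := K) hG
    have hprec : p (prec K (ofForest K F₁) (ofForest K F₂)) (ofForest K G) =
        q (prec K (ofForest K F₁) (ofForest K F₂)) (ofForest K G) := by
      rw [hp.prec_left _ h₁ _ h₂ _ hG, hq.prec_left _ h₁ _ h₂ _ hG, tensorForm_deltaPrec,
        tensorForm_deltaPrec]
      exact Finset.sum_congr rfl fun c _ => by rw [ih _ hs₁ F₁ _ rfl, ih _ hs₂ F₂ _ rfl]
    have hsucc : p (succ K (ofForest K F₁) (ofForest K F₂)) (ofForest K G) =
        q (succ K (ofForest K F₁) (ofForest K F₂)) (ofForest K G) := by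
      rw [hp.succ_left _ h₁ _ h₂ _ hG, hq.succ_left _ h₁ _ h₂ _ hG, tensorForm_deltaSucc,
        tensorForm_deltaSucc]
      exact Finset.sum_congr rfl fun c _ => by rw [ih _ hs₁ F₁ _ rfl, ih _ hs₂ F₂ _ rfl]
    rcases h with h | h
    · rw [h, hprec]
    · rw [h, map_add, map_add, LinearMap.add_apply, LinearMap.add_apply, hprec, hsucc]

theorem IsForestPairing.unique {p q : LinearMap.BilinForm K (HAlg K D)}
    (hp : IsForestPairing p) (hq : IsForestPairing q) : p = q :=
  hAlg_hom_ext fun F => hAlg_hom_ext fun G => hp.ofForest_eq hq F G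

end

end PlanarForest

end

open PlanarForest in
theorem mainTheorem12 (K : Type*) [Field K] (D : Type*) :
    (∃! p : LinearMap.BilinForm K (HAlg K D), IsForestPairing p) ∧
    ∀ p : LinearMap.BilinForm K (HAlg K D), IsForestPairing p →
      ∀ F G : PlanarForest D,
        p (ofForest K F) (ofForest K G) = (Nat.card (compatBij F G) : K) := by
  refine ⟨⟨countForm K, countForm_isForestPairing, fun p hp => hp.unique countForm_isForestPairing⟩,
    fun p hp F G => ?_⟩
  rw [hp.unique countForm_isForestPairing, countForm_ofForest]
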